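/- Let $X$ be an infinite set and let $X'=\{x' : x\in X\}$ be a disjoint copy of $X$. The \emph{partition monoid} $\mathcal P_X$ consists of all partitions $\alpha$ of $X\cup X'$ into nonempty blocks. For the product $\alpha\beta$, take a third copy $X''$ of $X$. Relabel the lower vertices $x'$ of $\alpha$, and the upper vertices $x$ of $\beta$, as $x''$, and form the graph on $X\cup X''\cup X'$ in which two vertices are joined if they lie in a common block of the relabelled $\alpha$ or of the relabelled $\beta$. Two elements of $X\cup X'$ lie in the same block of $\alpha\beta$ if and only if there is a path between them in this graph. Let $\mathcal E_X=\{\alpha\in\mathcal P_X:\alpha^2=\alpha\}$ be the set of idempotents and $\mathcal S_X$ the group of units of $\mathcal P_X$. Let $\mathcal L_X$ be the set of all $\alpha\in\mathcal P_X$ such that every $x\in X$ lies in a block meeting $X'$ and distinct elements of $X$ lie in distinct blocks. Let $\mathcal R_X$ be the set of all $\alpha\in\mathcal P_X$ such that every $x'\in X'$ lies in a block meeting $X$ and distinct elements of $X'$ lie in distinct blocks. If $\alpha$ has blocks $A_i\cup B_i'$ ($i\in I$) meeting both $X$ and $X'$, blocks $C_j$ ($j\in J$) contained in $X$, and blocks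 $D_k'$ ($k\in K$) contained in $X'$ (with $A_i,B_i,C_j,D_k\subseteq X$), define the cardinals \[ s(\alpha)=\sum_{i\in I}(|A_i|-1)+\sum_{j\in J}|C_j|,\qquad s^*(\alpha)=\sum_{i\in I}(|B_i|-1)+\sum_{k\in K}|D_k| \] (the singularity and cosingularity of $\alpha$), where $\mu-1=\mu$ for an infinite cardinal $\mu$. Write $\langle\Sigma\rangle$ for the subsemigroup generated by $\Sigma\subseteq\mathcal P_X$. \textbf{Theorem.} Let $X$ be any infinite set and let $\alpha,\beta\in\mathcal P_X$. The following are equivalent: \begin{enumerate} \item $\mathcal P_X=\langle\mathcal E_X\cup\{\alpha,\beta\}\rangle$; \item $\mathcal P_X=\langle\mathcal E_X\cup\mathcal S_X\cup\{\alpha,\beta\}\rangle$; \item either $\alpha\in\mathcal L_X$, $\beta\in\mathcal R_X$ and $s^*(\alpha)=s(\beta)=|X|$, or $\beta\in\mathcal L_X$, $\alpha\in\mathcal R_X$ and $s^*(\beta)=s(\alpha)=|X|$. \end{enumerate} -/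

import Mathlib

/-- An element of the partition monoid on `X`: a partition of `X ∪ X'` (two disjoint copies of `X`),
given by its equivalence relation.  `Sum.inl x` is the upper vertex `x` and `Sum.inr x` is the lower
vertex `x'`. -/
@[ext]
structure PartitionMonoid (X : Type*) where
  /-- the equivalence relation "belong to the same block" on `X ∪ X'` -/
  rel : Setoid (X ⊕ X)

namespace PartitionMonoid

/-- Vertices `X ∪ X'' ∪ X'` of the product graph: upper, middle and lower row. -/
inductive Vertex (X : Type*) where
  | upper (x : X) : Vertex X
  | middle (x : X) : Vertex X
  | lower (x : X) : Vertex X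

/-- The vertices of the first factor: the lower row `X'` is relabelled `X''`. -/
def Vertex.ofFirst {X : Type*} : X ⊕ X → Vertex X
  | Sum.inl x => Vertex.upper x
  | Sum.inr x => Vertex.middle x

/-- The vertices of the second factor: the upper row `X` is relabelled `X''`. -/
def Vertex.ofSecond {X : Type*} : X ⊕ X → Vertex X
  | Sum.inl x => Vertex.middle x
  | Sum.inr x => Vertex.lower x

/-- The vertices `X ∪ X'` of the product, inside the product graph. -/
def Vertex.ofOuter {X : Type*} : X ⊕ X → Vertex X
  | Sum.inl x => Vertex.upper x
  | Sum.inr x => Vertex.lower x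

/-- Edges of the product graph of `α` and `β`. -/
inductive ProductEdge {X : Type*} (α β : PartitionMonoid X) : Vertex X → Vertex X → Prop where
  | first (a b : X ⊕ X) (h : α.rel a b) :
      ProductEdge α β (Vertex.ofFirst a) (Vertex.ofFirst b)
  | second (a b : X ⊕ X) (h : β.rel a b) :
      ProductEdge α β (Vertex.ofSecond a) (Vertex.ofSecond b)

/-- Two vertices of the product graph are related when a path joins them. -/
def productGraph {X : Type*} (α β : PartitionMonoid X) : Setoid (Vertex X) :=
  Relation.EqvGen.setoid (ProductEdge α β)

/-- The product: two vertices of `X ∪ X'` are in the same block of `α * β` if and only if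
there is a path between them in the product graph. -/
instance {X : Type*} : Mul (PartitionMonoid X) where
  mul α β := ⟨(productGraph α β).comap Vertex.ofOuter⟩

/-- The identity: its blocks are the sets `{x, x'}`. -/
instance {X : Type*} : One (PartitionMonoid X) where
  one := ⟨Setoid.ker (Sum.elim id id)⟩

theorem mul_rel {X : Type*} (α β : PartitionMonoid X) (a b : X ⊕ X) :
    (α * β).rel a b ↔
      Relation.EqvGen (ProductEdge α β) (Vertex.ofOuter a) (Vertex.ofOuter b) := Iff.rfl

theorem one_rel {X : Type*} (a b : X ⊕ X) :
    (1 : PartitionMonoid X).rel a b ↔ (Sum.elim id id a : X) = Sum.elim id id b := Iff.rfl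

/-- If `F` is constant along the edges of a graph then it is constant along its paths. -/
theorem eq_of_eqvGen {V W : Type*} {r : V → V → Prop} (F : V → W)
    (hF : ∀ u v, r u v → F u = F v) {u v : V} (h : Relation.EqvGen r u v) : F u = F v := by
  induction h with
  | rel _ _ h => exact hF _ _ h
  | refl _ => rfl
  | symm _ _ _ ih => exact ih.symm
  | trans _ _ _ _ _ ih1 ih2 => exact ih1.trans ih2

/-- A map sending edges of one graph to paths of another sends paths to paths. -/
theorem eqvGen_map {V W : Type*} {r : V → V → Prop} {s : W → W → Prop} (F : V → W)
    (hF : ∀ u v, r u v → Relation.EqvGen s (F u) (F v)) {u v : V}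
    (h : Relation.EqvGen r u v) : Relation.EqvGen s (F u) (F v) := by
  induction h with
  | rel _ _ h => exact hF _ _ h
  | refl _ => exact .refl _
  | symm _ _ _ ih => exact .symm _ _ ih
  | trans _ _ _ _ _ ih1 ih2 => exact .trans _ _ _ ih1 ih2

/-- If `e` maps `V` into the vertices of `s`, edges of `r` come from paths of `s`, and every edge
of `s` is either inside the image of `e` and an edge of `r`, or inside a sub-graph `t` whose paths
between vertices in the image of `e` are edges of `r`, then paths of `s` and `r` agree on `V`. -/
theorem eqvGen_contract {V W U : Type*} {r : V → V → Prop} {s : W → W → Prop}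
    {t : U → U → Prop} (e : V → W) (g : U → W)
    (he : Function.Injective e) (hg : Function.Injective g)
    (h1 : ∀ u v, r u v → Relation.EqvGen s (e u) (e v))
    (h2 : ∀ w w', s w w' → (∃ u v, r u v ∧ e u = w ∧ e v = w') ∨
      (∃ p q, t p q ∧ g p = w ∧ g q = w'))
    (h3 : ∀ p q u v, Relation.EqvGen t p q → g p = e u → g q = e v → r u v)
    {u v : V} : Relation.EqvGen s (e u) (e v) ↔ Relation.EqvGen r u v := by
  refine ⟨fun h => ?_, fun h => eqvGen_map e h1 h⟩
  let F : W → Set V := fun w => {z | (∃ y, e y = w ∧ Relation.EqvGen r y z) ∨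
    (∃ p q y, g p = w ∧ Relation.EqvGen t p q ∧ g q = e y ∧ Relation.EqvGen r y z)}
  have hFe : ∀ y z, z ∈ F (e y) ↔ Relation.EqvGen r y z := by
    intro y z
    constructor
    · rintro (⟨y', hy, h⟩ | ⟨p, q, y', hp, hpq, hq, h⟩)
      · rwa [he hy] at h
      · exact .trans _ _ _ (.rel _ _ (h3 p q y y' hpq hp hq)) h
    · exact fun h => Or.inl ⟨y, rfl, h⟩
  have hsub : ∀ p q, Relation.EqvGen t p q → F (g p) ⊆ F (g q) := by
    rintro p q hpq z (⟨y, hy, h⟩ | ⟨p', q', y, hp, hpq', hq, h⟩)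
    · exact Or.inr ⟨q, p, y, rfl, .symm _ _ hpq, hy.symm, h⟩
    · rw [hg hp] at hpq'
      exact Or.inr ⟨q, q', y, rfl, .trans _ _ _ (.symm _ _ hpq) hpq', hq, h⟩
  have hF : ∀ w w', s w w' → F w = F w' := by
    intro w w' hw
    rcases h2 w w' hw with ⟨a, b, hab, rfl, rfl⟩ | ⟨p, q, hpq, rfl, rfl⟩
    · ext z
      rw [hFe, hFe]
      exact ⟨fun h => .trans _ _ _ (.symm _ _ (.rel _ _ hab)) h,
        fun h => .trans _ _ _ (.rel _ _ hab) h⟩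
    · exact Set.Subset.antisymm (hsub _ _ (.rel _ _ hpq)) (hsub _ _ (.symm _ _ (.rel _ _ hpq)))
  have := eq_of_eqvGen F hF h
  rw [← hFe, this, hFe]
  exact .refl _

/-- Four rows of vertices, used for products of three partitions. -/
inductive Vertex4 (X : Type*) where
  | row (i : Fin 4) (x : X) : Vertex4 X

/-- The two consecutive rows `i` and `i + 1`. -/
def Vertex4.of {X : Type*} (i : Fin 3) : X ⊕ X → Vertex4 X
  | Sum.inl x => Vertex4.row i.castSucc x
  | Sum.inr x => Vertex4.row i.succ x

/-- Edges of the product graph of three partitions. -/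
inductive ProductEdge3 {X : Type*} (α β γ : PartitionMonoid X) :
    Vertex4 X → Vertex4 X → Prop where
  | first (a b : X ⊕ X) (h : α.rel a b) : ProductEdge3 α β γ (Vertex4.of 0 a) (Vertex4.of 0 b)
  | second (a b : X ⊕ X) (h : β.rel a b) : ProductEdge3 α β γ (Vertex4.of 1 a) (Vertex4.of 1 b)
  | third (a b : X ⊕ X) (h : γ.rel a b) : ProductEdge3 α β γ (Vertex4.of 2 a) (Vertex4.of 2 b)

/-- Three of the four rows. -/
def Vertex4.ofThree {X : Type*} (i j k : Fin 4) : Vertex X → Vertex4 X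
  | Vertex.upper x => Vertex4.row i x
  | Vertex.middle x => Vertex4.row j x
  | Vertex.lower x => Vertex4.row k x

theorem Vertex4.ofThree_injective {X : Type*} {i j k : Fin 4} (hij : i ≠ j) (hik : i ≠ k)
    (hjk : j ≠ k) : Function.Injective (Vertex4.ofThree (X := X) i j k) := by
  rintro (x | x | x) (y | y | y) h <;> simp_all [Vertex4.ofThree, eq_comm]

theorem mul_mul_rel_left {X : Type*} (α β γ : PartitionMonoid X) (u v : Vertex X) :
    Relation.EqvGen (ProductEdge3 α β γ) (Vertex4.ofThree 0 2 3 u) (Vertex4.ofThree 0 2 3 v) ↔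
      Relation.EqvGen (ProductEdge (α * β) γ) u v := by
  refine eqvGen_contract (t := ProductEdge α β) (Vertex4.ofThree 0 2 3) (Vertex4.ofThree 0 1 2)
    (Vertex4.ofThree_injective (by decide) (by decide) (by decide))
    (Vertex4.ofThree_injective (by decide) (by decide) (by decide)) ?_ ?_ ?_
  · rintro _ _ (⟨a, b, h⟩ | ⟨a, b, h⟩)
    · rw [mul_rel] at h
      have := eqvGen_map (s := ProductEdge3 α β γ) (Vertex4.ofThree 0 1 2) (by
        rintro _ _ (⟨a, b, h⟩ | ⟨a, b, h⟩)
        · have := ProductEdge3.first (β := β) (γ := γ) a b h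
          rcases a with a | a <;> rcases b with b | b <;> exact .rel _ _ this
        · have := ProductEdge3.second (α := α) (γ := γ) a b h
          rcases a with a | a <;> rcases b with b | b <;> exact .rel _ _ this) h
      rcases a with a | a <;> rcases b with b | b <;> exact this
    · have := ProductEdge3.third (α := α) (β := β) a b h
      rcases a with a | a <;> rcases b with b | b <;> exact .rel _ _ this
  · rintro _ _ (⟨a, b, h⟩ | ⟨a, b, h⟩ | ⟨a, b, h⟩)
    · refine Or.inr ⟨_, _, ProductEdge.first a b h, ?_, ?_⟩
      · rcases a with a | a <;> rfl
      · rcases b with b | b <;> rfl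
    · refine Or.inr ⟨_, _, ProductEdge.second a b h, ?_, ?_⟩
      · rcases a with a | a <;> rfl
      · rcases b with b | b <;> rfl
    · refine Or.inl ⟨_, _, ProductEdge.second a b h, ?_, ?_⟩
      · rcases a with a | a <;> rfl
      · rcases b with b | b <;> rfl
  · intro p q u v h hp hq
    have key : ∀ (p : Vertex X) (u : Vertex X),
        Vertex4.ofThree 0 1 2 p = Vertex4.ofThree 0 2 3 u →
        ∃ a, p = Vertex.ofOuter a ∧ u = Vertex.ofFirst a := by
      rintro (x | x | x) (y | y | y) h <;> simp [Vertex4.ofThree] at h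
      · exact ⟨Sum.inl x, rfl, by rw [h]; rfl⟩
      · exact ⟨Sum.inr x, rfl, by rw [h]; rfl⟩
    obtain ⟨a, rfl, rfl⟩ := key _ _ hp
    obtain ⟨b, rfl, rfl⟩ := key _ _ hq
    exact .first a b h

theorem mul_mul_rel_right {X : Type*} (α β γ : PartitionMonoid X) (u v : Vertex X) :
    Relation.EqvGen (ProductEdge3 α β γ) (Vertex4.ofThree 0 1 3 u) (Vertex4.ofThree 0 1 3 v) ↔
      Relation.EqvGen (ProductEdge α (β * γ)) u v := by
  refine eqvGen_contract (t := ProductEdge β γ) (Vertex4.ofThree 0 1 3) (Vertex4.ofThree 1 2 3)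
    (Vertex4.ofThree_injective (by decide) (by decide) (by decide))
    (Vertex4.ofThree_injective (by decide) (by decide) (by decide)) ?_ ?_ ?_
  · rintro _ _ (⟨a, b, h⟩ | ⟨a, b, h⟩)
    · have := ProductEdge3.first (β := β) (γ := γ) a b h
      rcases a with a | a <;> rcases b with b | b <;> exact .rel _ _ this
    · rw [mul_rel] at h
      have := eqvGen_map (s := ProductEdge3 α β γ) (Vertex4.ofThree 1 2 3) (by
        rintro _ _ (⟨a, b, h⟩ | ⟨a, b, h⟩)
        · have := ProductEdge3.second (α := α) (γ := γ) a b h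
          rcases a with a | a <;> rcases b with b | b <;> exact .rel _ _ this
        · have := ProductEdge3.third (α := α) (β := β) a b h
          rcases a with a | a <;> rcases b with b | b <;> exact .rel _ _ this) h
      rcases a with a | a <;> rcases b with b | b <;> exact this
  · rintro _ _ (⟨a, b, h⟩ | ⟨a, b, h⟩ | ⟨a, b, h⟩)
    · refine Or.inl ⟨_, _, ProductEdge.first a b h, ?_, ?_⟩
      · rcases a with a | a <;> rfl
      · rcases b with b | b <;> rfl
    · refine Or.inr ⟨_, _, ProductEdge.first a b h, ?_, ?_⟩
      · rcases a with a | a <;> rfl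
      · rcases b with b | b <;> rfl
    · refine Or.inr ⟨_, _, ProductEdge.second a b h, ?_, ?_⟩
      · rcases a with a | a <;> rfl
      · rcases b with b | b <;> rfl
  · intro p q u v h hp hq
    have key : ∀ (p : Vertex X) (u : Vertex X),
        Vertex4.ofThree 1 2 3 p = Vertex4.ofThree 0 1 3 u →
        ∃ a, p = Vertex.ofOuter a ∧ u = Vertex.ofSecond a := by
      rintro (x | x | x) (y | y | y) h <;> simp [Vertex4.ofThree] at h
      · exact ⟨Sum.inl x, rfl, by rw [h]; rfl⟩
      · exact ⟨Sum.inr x, rfl, by rw [h]; rfl⟩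
    obtain ⟨a, rfl, rfl⟩ := key _ _ hp
    obtain ⟨b, rfl, rfl⟩ := key _ _ hq
    exact .second a b h

theorem mul_assoc' {X : Type*} (α β γ : PartitionMonoid X) : α * β * γ = α * (β * γ) := by
  apply PartitionMonoid.ext
  ext a b
  rw [mul_rel, mul_rel, ← mul_mul_rel_left, ← mul_mul_rel_right]
  rcases a with a | a <;> rcases b with b | b <;> exact Iff.rfl

theorem one_mul' {X : Type*} (α : PartitionMonoid X) : 1 * α = α := by
  apply PartitionMonoid.ext
  ext a b
  rw [mul_rel]
  have step : ∀ a : X ⊕ X, Relation.EqvGen (ProductEdge 1 α) (Vertex.ofOuter a)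
      (Vertex.ofSecond a) := by
    rintro (x | x)
    · exact .rel _ _ (.first (Sum.inl x) (Sum.inr x) rfl)
    · exact .refl _
  constructor
  · intro h
    let f : Vertex X → X ⊕ X := fun u => match u with
      | .upper x => Sum.inl x
      | .middle x => Sum.inl x
      | .lower x => Sum.inr x
    have := eq_of_eqvGen (fun u => (Quotient.mk α.rel (f u))) (by
      rintro _ _ (⟨a, b, h⟩ | ⟨a, b, h⟩)
      · rw [one_rel] at h
        rcases a with a | a <;> rcases b with b | b <;>
          · simp only [Sum.elim_inl, Sum.elim_inr, id] at h
            subst h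
            rfl
      · rcases a with a | a <;> rcases b with b | b <;> exact Quotient.sound h) h
    rcases a with a | a <;> rcases b with b | b <;> exact Quotient.exact this
  · intro h
    exact .trans _ _ _ (step a) (.trans _ _ _ (.rel _ _ (.second a b h)) (.symm _ _ (step b)))

theorem mul_one' {X : Type*} (α : PartitionMonoid X) : α * 1 = α := by
  apply PartitionMonoid.ext
  ext a b
  rw [mul_rel]
  have step : ∀ a : X ⊕ X, Relation.EqvGen (ProductEdge α 1) (Vertex.ofFirst a)
      (Vertex.ofOuter a) := by
    rintro (x | x)
    · exact .refl _
    · exact .rel _ _ (.second (Sum.inl x) (Sum.inr x) rfl)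
  constructor
  · intro h
    let f : Vertex X → X ⊕ X := fun u => match u with
      | .upper x => Sum.inl x
      | .middle x => Sum.inr x
      | .lower x => Sum.inr x
    have := eq_of_eqvGen (fun u => (Quotient.mk α.rel (f u))) (by
      rintro _ _ (⟨a, b, h⟩ | ⟨a, b, h⟩)
      · rcases a with a | a <;> rcases b with b | b <;> exact Quotient.sound h
      · rw [one_rel] at h
        rcases a with a | a <;> rcases b with b | b <;>
          · simp only [Sum.elim_inl, Sum.elim_inr, id] at h
            subst h
            rfl) h
    rcases a with a | a <;> rcases b with b | b <;> exact Quotient.exact this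
  · intro h
    exact .trans _ _ _ (.symm _ _ (step a)) (.trans _ _ _ (.rel _ _ (.first a b h)) (step b))

instance {X : Type*} : Monoid (PartitionMonoid X) where
  mul_assoc := mul_assoc'
  one_mul := one_mul'
  mul_one := mul_one'

/-- The set `E_X` of idempotents. -/
def E (X : Type*) : Set (PartitionMonoid X) := {α | IsIdempotentElem α}

/-- The group of units `S_X`, as a set. -/
def S (X : Type*) : Set (PartitionMonoid X) := {α | IsUnit α}

/-- The domain: the `x` whose block meets the lower row. -/
def dom {X : Type*} (α : PartitionMonoid X) : Set X := {x | ∃ y, α.rel (Sum.inl x) (Sum.inr y)}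

/-- The codomain: the `x` such that the block of `x'` meets the upper row. -/
def codom {X : Type*} (α : PartitionMonoid X) : Set X := {x | ∃ y, α.rel (Sum.inr x) (Sum.inl y)}

/-- The kernel: `x` and `y` are upper vertices in the same block. -/
def ker {X : Type*} (α : PartitionMonoid X) : Setoid X := α.rel.comap Sum.inl

/-- The cokernel: `x'` and `y'` are lower vertices in the same block. -/
def coker {X : Type*} (α : PartitionMonoid X) : Setoid X := α.rel.comap Sum.inr

/-- `L_X`: full domain and trivial kernel (`⊥` is the equality relation). -/
def L (X : Type*) : Set (PartitionMonoid X) := {α | α.dom = Set.univ ∧ α.ker = ⊥}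

/-- `R_X`: full codomain and trivial cokernel. -/
def R (X : Type*) : Set (PartitionMonoid X) := {α | α.codom = Set.univ ∧ α.coker = ⊥}

/-- The blocks of a partition. -/
def blocks {X : Type*} (α : PartitionMonoid X) : Set (Set (X ⊕ X)) := α.rel.classes

/-- The part of `B` in the upper row, as a subset of `X`. -/
def upperPart {X : Type*} (B : Set (X ⊕ X)) : Set X := Sum.inl ⁻¹' B

/-- The part of `B` in the lower row, as a subset of `X`. -/
def lowerPart {X : Type*} (B : Set (X ⊕ X)) : Set X := Sum.inr ⁻¹' B

/-- Blocks meeting both rows. -/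
def transversals {X : Type*} (α : PartitionMonoid X) : Set (Set (X ⊕ X)) :=
  {B | B ∈ α.blocks ∧ (upperPart B).Nonempty ∧ (lowerPart B).Nonempty}

/-- Blocks contained in the upper row. -/
def upperNontransversals {X : Type*} (α : PartitionMonoid X) : Set (Set (X ⊕ X)) :=
  {B | B ∈ α.blocks ∧ lowerPart B = ∅}

/-- Blocks contained in the lower row. -/
def lowerNontransversals {X : Type*} (α : PartitionMonoid X) : Set (Set (X ⊕ X)) :=
  {B | B ∈ α.blocks ∧ upperPart B = ∅}

/-- `c - 1` for a nonzero cardinal `c`: the cardinal `d` with `d + 1 = c`. -/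
noncomputable def subOne (c : Cardinal) : Cardinal := sInf {d | d + 1 = c}

theorem subOne_add_one {c : Cardinal} (hc : c ≠ 0) : subOne c + 1 = c := by
  have h : {d : Cardinal | d + 1 = c}.Nonempty := by
    rcases lt_or_ge c Cardinal.aleph0 with h | h
    · obtain ⟨n, rfl⟩ := Cardinal.lt_aleph0.1 h
      obtain ⟨m, rfl⟩ := Nat.exists_eq_succ_of_ne_zero (n := n) (by simpa using hc)
      exact ⟨m, by simp⟩
    · exact ⟨c, Cardinal.add_one_eq h⟩
  exact csInf_mem h

theorem subOne_eq_iff {c d : Cardinal} (hc : c ≠ 0) : subOne c = d ↔ d + 1 = c := by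
  refine ⟨fun h => h ▸ subOne_add_one hc, fun h => ?_⟩
  exact Cardinal.add_one_inj.1 ((subOne_add_one hc).trans h.symm)

/-- The singularity `s(α) = ∑ (|A_i| - 1) + ∑ |C_j|`, where the `A_i` are the upper parts of the
transversal blocks and the `C_j` are the upper nontransversal blocks. -/
noncomputable def sing {X : Type*} (α : PartitionMonoid X) : Cardinal :=
  Cardinal.sum (fun B : α.transversals => subOne (Cardinal.mk (upperPart B.1))) +
    Cardinal.sum (fun B : α.upperNontransversals => Cardinal.mk (upperPart B.1))

/-- The cosingularity `s*(α) = ∑ (|B_i| - 1) + ∑ |D_k|`, where the `B_i` are the lower parts of the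
transversal blocks and the `D_k` are the lower nontransversal blocks. -/
noncomputable def cosing {X : Type*} (α : PartitionMonoid X) : Cardinal :=
  Cardinal.sum (fun B : α.transversals => subOne (Cardinal.mk (lowerPart B.1))) +
    Cardinal.sum (fun B : α.lowerNontransversals => Cardinal.mk (lowerPart B.1))

end PartitionMonoid

/-! The involution `star` reverses products and exchanges `L X` with `R X`, so each argument is
needed on one side only. The elements of `L X` are exactly the right-invertible ones, those of `R X`
the left-invertible ones, and elements of both are units. Cosingularity is replaced by the
cardinality of a set, `lowerDefect`: the sum and the cardinality agree up to a factor of 2, so one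
equals |X| exactly when the other does.

Sufficiency: multiplying α ∈ L by an idempotent turns it into `graph f` for an injection f whose
range has complement of size |X|; dually β yields the flip of some `graph g`. Further idempotents
move f to an injection h with range disjoint from that of g. Then X contains independent copies h(X)
and g(X) of the two rows, any γ can be encoded on them by an idempotent e, and γ = `graph h * e *
(graph g).star` (`exists_graph_mul_mul_star_graph`).

Necessity: every left factor of an element of L lies in L, and the only idempotent in L is 1. If all
generators in L were units, every element of L would be a unit, which is false for infinite X; so α
or β lies in L but not in R, and dually one lies in R but not in L (`exists_mem_L_notMem_R`). These
must be different elements. If the one in L had defect below |X|, no product in L could reach defect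
|X|: units and the generator in R have empty lower defect, and an idempotent e with γe ∈ L has lower
defect at most four times that of γ (`mk_lowerDefect_star_le`, `mk_lowerDefect_le_of_mem_E`). But L
does contain elements of defect |X|. -/

namespace PartitionMonoid

open Relation Cardinal

variable {X : Type*}

/-! ### The involution -/

/-- Turning a partition upside down. -/
def star (α : PartitionMonoid X) : PartitionMonoid X := ⟨α.rel.comap Sum.swap⟩

@[simp] theorem star_rel (α : PartitionMonoid X) (a b : X ⊕ X) :
    α.star.rel a b ↔ α.rel a.swap b.swap := Iff.rfl

@[simp] theorem star_star (α : PartitionMonoid X) : α.star.star = α := by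
  apply PartitionMonoid.ext
  ext a b
  simp

/-- Turning the product graph upside down. -/
def Vertex.swap : Vertex X → Vertex X
  | .upper x => .lower x
  | .middle x => .middle x
  | .lower x => .upper x

theorem eqvGen_swap {α β : PartitionMonoid X} {u v : Vertex X}
    (h : EqvGen (ProductEdge α β) u v) :
    EqvGen (ProductEdge β.star α.star) u.swap v.swap := by
  refine eqvGen_map Vertex.swap ?_ h
  rintro _ _ (⟨a, b, h⟩ | ⟨a, b, h⟩)
  · have := ProductEdge.second (α := β.star) (β := α.star) a.swap b.swap (by simpa using h)
    rcases a with a | a <;> rcases b with b | b <;> exact .rel _ _ this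
  · have := ProductEdge.first (α := β.star) (β := α.star) a.swap b.swap (by simpa using h)
    rcases a with a | a <;> rcases b with b | b <;> exact .rel _ _ this

theorem star_mul (α β : PartitionMonoid X) : (α * β).star = β.star * α.star := by
  apply PartitionMonoid.ext
  ext a b
  rw [star_rel, mul_rel, mul_rel]
  constructor
  · intro h
    have := eqvGen_swap h
    rcases a with a | a <;> rcases b with b | b <;> exact this
  · intro h
    have := eqvGen_swap h
    rw [star_star, star_star] at this
    rcases a with a | a <;> rcases b with b | b <;> exact this

@[simp] theorem star_one : (1 : PartitionMonoid X).star = 1 := by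
  apply PartitionMonoid.ext
  ext a b
  rw [star_rel, one_rel, one_rel]
  rcases a with a | a <;> rcases b with b | b <;> exact Iff.rfl

theorem star_mem_E {α : PartitionMonoid X} (h : α ∈ E X) : α.star ∈ E X := by
  change α.star * α.star = α.star
  rw [← star_mul, show α * α = α from h]

theorem star_mem_S {α : PartitionMonoid X} (h : α ∈ S X) : α.star ∈ S X := by
  obtain ⟨u, rfl⟩ := h
  refine ⟨⟨(u : PartitionMonoid X).star, (↑u⁻¹ : PartitionMonoid X).star, ?_, ?_⟩, rfl⟩ <;>
    rw [← star_mul] <;> simp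

theorem star_mem_R {α : PartitionMonoid X} : α.star ∈ R X ↔ α ∈ L X := Iff.rfl

theorem star_mem_L {α : PartitionMonoid X} : α.star ∈ L X ↔ α ∈ R X := Iff.rfl

/-! ### One-sided units -/

theorem eq_of_mem_L {α : PartitionMonoid X} (h : α ∈ L X) {x y : X}
    (hxy : α.rel (Sum.inl x) (Sum.inl y)) : x = y := by
  have : α.ker x y := hxy
  rwa [h.2] at this

theorem exists_rel_of_mem_L {α : PartitionMonoid X} (h : α ∈ L X) (x : X) :
    ∃ y, α.rel (Sum.inl x) (Sum.inr y) := by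
  have : x ∈ α.dom := h.1 ▸ Set.mem_univ x
  exact this

theorem mul_rel_inl {α : PartitionMonoid X} (β : PartitionMonoid X) {x y : X}
    (h : α.rel (Sum.inl x) (Sum.inl y)) : (α * β).rel (Sum.inl x) (Sum.inl y) :=
  .rel _ _ (.first _ _ h)

theorem mul_rel_inr (α : PartitionMonoid X) {β : PartitionMonoid X} {x y : X}
    (h : β.rel (Sum.inr x) (Sum.inr y)) : (α * β).rel (Sum.inr x) (Sum.inr y) :=
  .rel _ _ (.second _ _ h)

theorem mul_rel_inl_inr {α β : PartitionMonoid X} {x y z : X}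
    (h : α.rel (Sum.inl x) (Sum.inr z)) (h' : β.rel (Sum.inl z) (Sum.inr y)) :
    (α * β).rel (Sum.inl x) (Sum.inr y) :=
  .trans _ _ _ (.rel _ _ (.first _ _ h)) (.rel _ _ (.second _ _ h'))

theorem mul_rel_inl_inl {α β : PartitionMonoid X} {x y z w : X}
    (h : α.rel (Sum.inl x) (Sum.inr z)) (h' : β.rel (Sum.inl z) (Sum.inl w))
    (h'' : α.rel (Sum.inl y) (Sum.inr w)) :
    (α * β).rel (Sum.inl x) (Sum.inl y) :=
  .trans _ _ _ (.rel _ _ (.first _ _ h)) (.trans _ _ _ (.rel _ _ (.second _ _ h'))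
    (.symm _ _ (.rel _ _ (.first _ _ h''))))

/-- A set of vertices closed under the edges of the product graph is closed under its paths. -/
theorem mem_of_eqvGen {α β : PartitionMonoid X} (N : Vertex X → Prop)
    (hα : ∀ a b, α.rel a b → N (Vertex.ofFirst a) → N (Vertex.ofFirst b))
    (hβ : ∀ a b, β.rel a b → N (Vertex.ofSecond a) → N (Vertex.ofSecond b))
    {u v : Vertex X} (h : EqvGen (ProductEdge α β) u v) (hu : N u) : N v := by
  have := eq_of_eqvGen N (by
    rintro _ _ (⟨a, b, h⟩ | ⟨a, b, h⟩)
    · exact propext ⟨hα _ _ h, hα _ _ (α.rel.symm h)⟩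
    · exact propext ⟨hβ _ _ h, hβ _ _ (β.rel.symm h)⟩) h
  rwa [← this]

/-- Each block of α meeting the upper row has a single upper vertex z. Label z in both outer rows,
and every lower vertex of its block in the middle row, by z; edges preserve labels, so paths join
only z to z'. -/
theorem mul_star_of_mem_L {α : PartitionMonoid X} (h : α ∈ L X) : α * α.star = 1 := by
  apply PartitionMonoid.ext
  ext a b
  rw [one_rel]
  constructor
  · intro hab
    let N : X → Vertex X → Prop := fun z v => match v with
      | .upper x => z = x
      | .middle y => α.rel (Sum.inl z) (Sum.inr y)
      | .lower x => z = x
    have key : ∀ z, N z (Vertex.ofOuter a) → N z (Vertex.ofOuter b) := by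
      intro z
      refine mem_of_eqvGen (N z) ?_ ?_ hab
      · rintro (a | a) (b | b) hab h1
        · exact h1.trans (eq_of_mem_L h hab)
        · obtain rfl : z = a := h1
          exact hab
        · exact eq_of_mem_L h (α.rel.trans h1 hab)
        · exact α.rel.trans h1 hab
      · rintro (a | a) (b | b) hab h1
        · exact α.rel.trans h1 hab
        · exact eq_of_mem_L h (α.rel.trans h1 hab)
        · obtain rfl : z = a := h1
          exact hab
        · exact h1.trans (eq_of_mem_L h hab)
    rcases a with a | a <;> rcases b with b | b <;> exact key a rfl
  · have step : ∀ x, (α * α.star).rel (Sum.inl x) (Sum.inr x) := by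
      intro x
      obtain ⟨y, hy⟩ := exists_rel_of_mem_L h x
      exact mul_rel_inl_inr hy (by simpa using α.rel.symm hy)
    intro hab
    rcases a with a | a <;> rcases b with b | b <;>
      · simp only [Sum.elim_inl, Sum.elim_inr, id] at hab
        subst hab
        first
        | exact (α * α.star).rel.refl _
        | exact step _
        | exact (α * α.star).rel.symm (step _)

/-- An upper block of α that misses the lower row stays a block of every product αβ, and the kernel
of α is contained in that of αβ; neither is compatible with αβ = 1 unless α ∈ L. -/
theorem mem_L_of_mul_eq_one {α β : PartitionMonoid X} (h : α * β = 1) : α ∈ L X := by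
  constructor
  · ext x
    simp only [Set.mem_univ, iff_true]
    by_contra hx
    have hx' : ∀ y, ¬ α.rel (Sum.inl x) (Sum.inr y) := fun y hy => hx ⟨y, hy⟩
    have hone : (α * β).rel (Sum.inl x) (Sum.inr x) := by
      rw [h]
      exact rfl
    let N : Vertex X → Prop := fun v => match v with
      | .upper y => α.rel (Sum.inl x) (Sum.inl y)
      | _ => False
    refine mem_of_eqvGen N ?_ ?_ hone (α.rel.refl _)
    · rintro (a | a) (b | b) hab h1
      · exact α.rel.trans h1 hab
      · exact hx' _ (α.rel.trans h1 hab)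
      · exact h1.elim
      · exact h1.elim
    · rintro (a | a) (b | b) hab h1 <;> exact h1.elim
  · ext x y
    constructor
    · intro hxy
      have := mul_rel_inl β hxy
      rw [h] at this
      exact this
    · rintro rfl
      exact α.ker.refl _

theorem mem_L_iff {α : PartitionMonoid X} : α ∈ L X ↔ ∃ β, α * β = 1 :=
  ⟨fun h => ⟨_, mul_star_of_mem_L h⟩, fun ⟨_, h⟩ => mem_L_of_mul_eq_one h⟩

theorem mem_R_iff {α : PartitionMonoid X} : α ∈ R X ↔ ∃ β, β * α = 1 := by
  rw [← star_mem_L, mem_L_iff]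
  constructor
  · rintro ⟨β, h⟩
    refine ⟨β.star, ?_⟩
    rw [← star_star α, ← star_mul, h, star_one]
  · rintro ⟨β, h⟩
    exact ⟨β.star, by rw [← star_mul, h, star_one]⟩

theorem mem_L_of_mul {α β : PartitionMonoid X} (h : α * β ∈ L X) : α ∈ L X := by
  obtain ⟨δ, h⟩ := mem_L_iff.1 h
  exact mem_L_iff.2 ⟨β * δ, by rw [← mul_assoc, h]⟩

theorem isUnit_of_mem {α : PartitionMonoid X} (hL : α ∈ L X) (hR : α ∈ R X) : IsUnit α := by
  obtain ⟨β, hβ⟩ := mem_L_iff.1 hL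
  obtain ⟨γ, hγ⟩ := mem_R_iff.1 hR
  have : γ = β := left_inv_eq_right_inv hγ hβ
  exact ⟨⟨α, β, hβ, this ▸ hγ⟩, rfl⟩

theorem mem_R_of_isUnit {α : PartitionMonoid X} (h : IsUnit α) : α ∈ R X := by
  obtain ⟨u, rfl⟩ := h
  exact mem_R_iff.2 ⟨_, u.inv_mul⟩

theorem eq_one_of_mem_E_of_mem_L {e : PartitionMonoid X} (he : e ∈ E X) (h : e ∈ L X) :
    e = 1 := by
  obtain ⟨δ, hδ⟩ := mem_L_iff.1 h
  calc e = e * (e * δ) := by rw [hδ, mul_one]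
    _ = e * δ := by rw [← mul_assoc, show e * e = e from he]
    _ = 1 := hδ

theorem mem_L_of_mul_of_isUnit {α β : PartitionMonoid X} (hα : IsUnit α) (h : α * β ∈ L X) :
    β ∈ L X := by
  obtain ⟨u, rfl⟩ := hα
  obtain ⟨δ, hδ⟩ := mem_L_iff.1 h
  refine mem_L_iff.2 ⟨δ * u, ?_⟩
  rw [← mul_assoc]
  have : β * δ = ↑u⁻¹ := by
    rw [← Units.inv_mul_cancel_left u (β * δ), ← mul_assoc (u : PartitionMonoid X), hδ, mul_one]
  rw [this, u.inv_mul]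

theorem mul_mem_R {α β : PartitionMonoid X} (hα : α ∈ R X) (hβ : β ∈ R X) : α * β ∈ R X := by
  obtain ⟨γ, hγ⟩ := mem_R_iff.1 hα
  obtain ⟨δ, hδ⟩ := mem_R_iff.1 hβ
  refine mem_R_iff.2 ⟨δ * γ, ?_⟩
  rw [mul_assoc, ← mul_assoc γ, hγ, one_mul, hδ]

/-! ### Defects -/

/-- The lower vertices which are not the only lower vertex of a transversal block. -/
def lowerDefect (α : PartitionMonoid X) : Set X :=
  {y | ¬ ((∃ x, α.rel (Sum.inl x) (Sum.inr y)) ∧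
    ∀ z, α.rel (Sum.inr y) (Sum.inr z) → z = y)}

theorem notMem_lowerDefect {α : PartitionMonoid X} {y : X} : y ∉ α.lowerDefect ↔
    (∃ x, α.rel (Sum.inl x) (Sum.inr y)) ∧ ∀ z, α.rel (Sum.inr y) (Sum.inr z) → z = y :=
  not_not

theorem notMem_lowerDefect_star {α : PartitionMonoid X} {x : X} : x ∉ α.star.lowerDefect ↔
    (∃ y, α.rel (Sum.inl x) (Sum.inr y)) ∧ ∀ z, α.rel (Sum.inl x) (Sum.inl z) → z = x := by
  rw [notMem_lowerDefect]
  exact and_congr_left fun _ => exists_congr fun _ => α.rel.comm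

theorem lowerDefect_of_mem_R {α : PartitionMonoid X} (h : α ∈ R X) : α.lowerDefect = ∅ := by
  refine Set.eq_empty_of_forall_notMem fun y => notMem_lowerDefect.2 ⟨?_, fun z hz => ?_⟩
  · obtain ⟨x, hx⟩ := exists_rel_of_mem_L (star_mem_L.2 h) y
    exact ⟨x, α.rel.symm hx⟩
  · exact (eq_of_mem_L (star_mem_L.2 h) hz).symm

/-- The counting device behind all defect estimates: points of A outside B choose `r`-partners in C,
and distinct points cannot share a partner. -/
theorem mk_le_add_of_rel {A B C : Set X} (r : X → X → Prop)
    (h : ∀ x ∈ A, x ∉ B → ∃ z ∈ C, r x z)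
    (hr : ∀ x y z, x ∉ B → y ∉ B → r x z → r y z → x = y) : #A ≤ #B + #C := by
  have h' : ∀ x : (A \ B : Set X), ∃ z : C, r x z := fun x => by
    obtain ⟨z, hz, hxz⟩ := h x x.2.1 x.2.2
    exact ⟨⟨z, hz⟩, hxz⟩
  choose f hf using h'
  have hinj : Function.Injective f := fun x y hxy =>
    Subtype.ext (hr _ _ _ x.2.2 y.2.2 (hf x) (hxy ▸ hf y))
  calc #A ≤ #(B ∪ (A \ B) : Set X) := mk_le_mk_of_subset (by simp)
    _ ≤ #B + #(A \ B : Set X) := mk_union_le _ _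
    _ ≤ #B + #C := by gcongr; exact mk_le_of_injective hinj

/-- If y is not defective for β but is for αβ, the upper part of its β-block contains a defective
lower vertex of α: otherwise α attaches each vertex of that part to the upper row without spreading
further, and y stays good. Different y have disjoint β-blocks. -/
theorem mk_lowerDefect_mul_le (α β : PartitionMonoid X) :
    #(α * β).lowerDefect ≤ #β.lowerDefect + #α.lowerDefect := by
  refine mk_le_add_of_rel (fun y a => β.rel (Sum.inl a) (Sum.inr y)) ?_ ?_
  · intro y hy hyβ
    obtain ⟨⟨a, ha⟩, hyu⟩ := notMem_lowerDefect.1 hyβ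
    by_contra! hcon
    have hgood : ∀ z, β.rel (Sum.inl z) (Sum.inr y) → _ := fun z hz =>
      notMem_lowerDefect.1 fun h => hcon z h hz
    refine hy ⟨?_, fun z hz => ?_⟩
    · obtain ⟨⟨x, hx⟩, -⟩ := hgood a ha
      exact ⟨x, mul_rel_inl_inr hx ha⟩
    -- `N` describes the component of y, whose only lower vertex is y itself.
    · let N : Vertex X → Prop := fun v => match v with
        | .upper x => ∃ z, β.rel (Sum.inl z) (Sum.inr y) ∧ α.rel (Sum.inl x) (Sum.inr z)
        | .middle z => β.rel (Sum.inl z) (Sum.inr y)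
        | .lower z => z = y
      refine mem_of_eqvGen N ?_ ?_ hz rfl
      · rintro (a | a) (b | b) hab h1
        · obtain ⟨z, hz, hza⟩ := h1
          exact ⟨z, hz, α.rel.trans (α.rel.symm hab) hza⟩
        · obtain ⟨z, hz, hza⟩ := h1
          obtain rfl := (hgood z hz).2 b (α.rel.trans (α.rel.symm hza) hab)
          exact hz
        · exact ⟨a, h1, α.rel.symm hab⟩
        · obtain rfl := (hgood a h1).2 b hab
          exact h1
      · rintro (a | a) (b | b) hab h1
        · exact β.rel.trans (β.rel.symm hab) h1
        · exact hyu b (β.rel.trans (β.rel.symm h1) hab)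
        · obtain rfl : a = y := h1
          exact β.rel.symm hab
        · obtain rfl : a = y := h1
          exact hyu b hab
  · intro x y z _ hy hxz hyz
    exact (notMem_lowerDefect.1 hy).2 x (β.rel.trans (β.rel.symm hyz) hxz)

/-- Two non-defective lower vertices of α cannot share an upper class of e, since that would merge
two upper vertices in αe. So an upper class of e with a non-defective vertex x has no other such
vertex. If it is also free of defective ones, it is {x}, and it must be transversal because αe has
full domain; then x is no upper defect of e. -/
theorem mk_lowerDefect_star_le {α e : PartitionMonoid X} (h : α * e ∈ L X) :
    #e.star.lowerDefect ≤ #α.lowerDefect + #α.lowerDefect := by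
  have key : ∀ x z, x ∉ α.lowerDefect → z ∉ α.lowerDefect →
      e.rel (Sum.inl x) (Sum.inl z) → z = x := by
    intro x z hx hz hxz
    obtain ⟨⟨u, hu⟩, hxu⟩ := notMem_lowerDefect.1 hx
    obtain ⟨⟨w, hw⟩, -⟩ := notMem_lowerDefect.1 hz
    obtain rfl := eq_of_mem_L h (mul_rel_inl_inl hu hxz hw)
    exact hxu z (α.rel.trans (α.rel.symm hu) hw)
  refine mk_le_add_of_rel (fun x z => e.rel (Sum.inl x) (Sum.inl z)) ?_ ?_
  · intro x hx hxα
    by_contra! hcon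
    have hK : ∀ z, e.rel (Sum.inl x) (Sum.inl z) → z = x := fun z hz =>
      key x z hxα (fun hzα => hcon z hzα hz) hz
    refine hx (notMem_lowerDefect.1 (notMem_lowerDefect_star.2 ⟨?_, hK⟩))
    by_contra! hdom
    obtain ⟨⟨u, hu⟩, hxu⟩ := notMem_lowerDefect.1 hxα
    obtain ⟨y, hy⟩ := exists_rel_of_mem_L h u
    let N : Vertex X → Prop := fun v => match v with
      | .upper w => α.rel (Sum.inl w) (Sum.inr x)
      | .middle z => z = x
      | .lower _ => False
    refine mem_of_eqvGen N ?_ ?_ hy hu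
    · rintro (a | a) (b | b) hab h1
      · exact α.rel.trans (α.rel.symm hab) h1
      · exact hxu b (α.rel.trans (α.rel.symm h1) hab)
      · obtain rfl : a = x := h1
        exact α.rel.symm hab
      · obtain rfl : a = x := h1
        exact hxu b hab
    · rintro (a | a) (b | b) hab h1
      · obtain rfl : a = x := h1
        exact hK b hab
      · obtain rfl : a = x := h1
        exact hdom b hab
      · exact h1.elim
      · exact h1.elim
  · intro x y z hx hy hxz hyz
    exact key y x hy hx (e.rel.trans hyz (e.rel.symm hxz))

/-- Let y be upper-good. If y is joined to z' with z upper-good, then z is joined to some w', and e²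
= e joins y to w', hence y to z, so z = y. Thus unless the block of y contains z' with z an upper
defect, it is {y, y'} and y is lower-good too. -/
theorem mk_lowerDefect_le_of_mem_E {e : PartitionMonoid X} (he : e ∈ E X) :
    #e.lowerDefect ≤ #e.star.lowerDefect + #e.star.lowerDefect := by
  refine mk_le_add_of_rel (fun x z => e.rel (Sum.inl x) (Sum.inr z)) ?_ ?_
  · intro y hy hyu
    obtain ⟨⟨b, hb⟩, hyK⟩ := notMem_lowerDefect_star.1 hyu
    by_contra! hcon
    have hB : ∀ z, e.rel (Sum.inl y) (Sum.inr z) → z = y := by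
      intro z hz
      obtain ⟨⟨w, hw⟩, -⟩ := notMem_lowerDefect_star.1 fun h => hcon z h hz
      have := mul_rel_inl_inr hz hw
      rw [show e * e = e from he] at this
      exact hyK z (e.rel.trans this (e.rel.symm hw))
    obtain rfl := hB b hb
    exact hy ⟨⟨b, hb⟩, fun z hz => hB z (e.rel.trans hb hz)⟩
  · intro x y z _ hy hxz hyz
    exact (notMem_lowerDefect_star.1 hy).2 x (e.rel.trans hyz (e.rel.symm hxz))

/-! ### Singularity and defects -/

theorem subOne_one : subOne 1 = 0 := (subOne_eq_iff one_ne_zero).2 (zero_add 1)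

theorem subOne_le (c : Cardinal) (hc : c ≠ 0) : subOne c ≤ c := by
  conv_rhs => rw [← subOne_add_one hc]
  exact self_le_add_right _ _

theorem le_subOne_add_subOne {c : Cardinal} (hc : c ≠ 0) (h1 : c ≠ 1) :
    c ≤ subOne c + subOne c := by
  conv_lhs => rw [← subOne_add_one hc]
  gcongr
  rw [Cardinal.one_le_iff_ne_zero]
  intro h
  rw [subOne_eq_iff hc, zero_add] at h
  exact h1 h.symm

/-- A singleton class contributes 0 to both the sum and the set; any other c satisfies c - 1 ≤ c ≤
2(c - 1). The two quantities therefore differ at most by a factor of 2, which cannot matter for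
reaching the infinite cardinal |X|. -/
theorem sum_subOne_add_sum_eq_mk_iff.{u} {X : Type u} [Infinite X] {I J : Type u}
    (A : I → Set X) (C : J → Set X)
    (hA : ∀ i, (A i).Nonempty) (hAA : ∀ i j x, x ∈ A i → x ∈ A j → i = j)
    (hCC : ∀ i j x, x ∈ C i → x ∈ C j → i = j) (hAC : ∀ i j x, x ∈ A i → x ∉ C j)
    (hcover : ∀ x, (∃ i, x ∈ A i) ∨ ∃ j, x ∈ C j) :
    (Cardinal.sum (fun i => subOne #(A i)) + Cardinal.sum (fun j => #(C j)) = #X) ↔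
      #{x | ∀ i, A i ≠ {x}} = #X := by
  set D : Set X := {x | ∀ i, A i ≠ {x}}
  have hCD : ∀ j, C j ⊆ D := by
    intro j x hx i hi
    exact hAC i j x (hi ▸ rfl) hx
  have hDeq : D = (⋃ i, A i ∩ D) ∪ ⋃ j, C j := by
    apply Set.Subset.antisymm
    · intro x hx
      rcases hcover x with ⟨i, hi⟩ | ⟨j, hj⟩
      · exact Or.inl (Set.mem_iUnion.2 ⟨i, hi, hx⟩)
      · exact Or.inr (Set.mem_iUnion.2 ⟨j, hj⟩)
    · exact Set.union_subset (Set.iUnion_subset fun i => Set.inter_subset_right)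
        (Set.iUnion_subset hCD)
  have hmk : #D = Cardinal.sum (fun i => #(A i ∩ D : Set X)) + Cardinal.sum (fun j => #(C j)) := by
    conv_lhs => rw [hDeq]
    rw [mk_union_of_disjoint, mk_iUnion_eq_sum_mk, mk_iUnion_eq_sum_mk]
    · exact fun i j hij => Set.disjoint_left.2 fun x hi hj => hij (hCC i j x hi hj)
    · exact fun i j hij => Set.disjoint_left.2 fun x hi hj => hij (hAA i j x hi.1 hj.1)
    · refine Set.disjoint_left.2 fun x hx hx' => ?_
      obtain ⟨i, hi⟩ := Set.mem_iUnion.1 hx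
      obtain ⟨j, hj⟩ := Set.mem_iUnion.1 hx'
      exact hAC i j x hi.1 hj
  have hterm : ∀ i, subOne #(A i) ≤ #(A i ∩ D : Set X) ∧
      #(A i ∩ D : Set X) ≤ subOne #(A i) + subOne #(A i) := by
    intro i
    have h0 : #(A i) ≠ 0 := by
      rw [mk_ne_zero_iff]
      exact (hA i).to_subtype
    by_cases h1 : #(A i) = 1
    · obtain ⟨x, hx⟩ := Cardinal.mk_set_eq_one_iff.1 h1
      have : A i ∩ D = ∅ := by
        refine Set.eq_empty_of_forall_notMem fun y hy => ?_
        obtain rfl : y = x := by simpa [hx] using hy.1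
        exact hy.2 i hx
      rw [h1, subOne_one, this]
      simp
    · have : A i ∩ D = A i := by
        refine Set.inter_eq_left.2 fun x hx j hj => h1 ?_
        obtain rfl := hAA i j x hx (hj ▸ rfl)
        rw [hj, mk_singleton]
      rw [this]
      exact ⟨subOne_le _ h0, le_subOne_add_subOne h0 h1⟩
  set s := Cardinal.sum (fun i => subOne #(A i)) + Cardinal.sum (fun j => #(C j))
  have hle : s ≤ #D := by
    rw [hmk]
    exact add_le_add (Cardinal.sum_le_sum _ _ fun i => (hterm i).1) le_rfl
  have hge : #D ≤ s + s := by
    calc #D ≤ Cardinal.sum (fun i => subOne #(A i) + subOne #(A i)) +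
          Cardinal.sum (fun j => #(C j)) := by
          rw [hmk]
          exact add_le_add (Cardinal.sum_le_sum _ _ fun i => (hterm i).2) le_rfl
      _ = (Cardinal.sum (fun i => subOne #(A i)) + Cardinal.sum (fun i => subOne #(A i))) +
          Cardinal.sum (fun j => #(C j)) := by rw [Cardinal.sum_add_distrib']
      _ ≤ (Cardinal.sum (fun i => subOne #(A i)) + Cardinal.sum (fun i => subOne #(A i))) +
          (Cardinal.sum (fun j => #(C j)) + Cardinal.sum (fun j => #(C j))) := by
          gcongr
          exact self_le_add_right _ _
      _ = s + s := by rw [add_add_add_comm]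
  constructor
  · intro h
    exact le_antisymm (mk_set_le D) (h ▸ hle)
  · intro h
    refine le_antisymm (hle.trans (mk_set_le D)) (not_lt.1 fun hlt => ?_)
    exact absurd (h ▸ hge) (not_le.2 (add_lt_of_lt (aleph0_le_mk X) hlt hlt))

theorem eq_of_mem_blocks {α : PartitionMonoid X} {B B' : Set (X ⊕ X)} (hB : B ∈ α.blocks)
    (hB' : B' ∈ α.blocks) {a : X ⊕ X} (h : a ∈ B) (h' : a ∈ B') : B = B' :=
  Setoid.eq_of_mem_classes hB h hB' h'

theorem rel_of_mem_blocks {α : PartitionMonoid X} {B : Set (X ⊕ X)} (hB : B ∈ α.blocks)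
    {a b : X ⊕ X} (h : a ∈ B) : b ∈ B ↔ α.rel a b := by
  obtain ⟨c, rfl⟩ := hB
  exact ⟨fun h' => α.rel.trans h (α.rel.symm h'), fun h' => α.rel.trans (α.rel.symm h') h⟩

theorem cosing_eq_mk_iff [Infinite X] (α : PartitionMonoid X) :
    α.cosing = #X ↔ #α.lowerDefect = #X := by
  rw [cosing, sum_subOne_add_sum_eq_mk_iff (fun B : α.transversals => lowerPart B.1)
    (fun B : α.lowerNontransversals => lowerPart B.1)]
  · suffices h : {x | ∀ i : α.transversals, lowerPart i.1 ≠ {x}} = α.lowerDefect by rw [h]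
    ext y
    rw [← not_iff_not, notMem_lowerDefect]
    refine not_forall.trans ⟨?_, ?_⟩
    · rintro ⟨⟨B, hB, ⟨x, hx⟩, _⟩, h⟩
      rw [not_not] at h
      have hy : Sum.inr y ∈ B := show y ∈ lowerPart B from h ▸ rfl
      refine ⟨⟨x, (rel_of_mem_blocks hB hx).1 hy⟩, fun z hz => ?_⟩
      have : z ∈ lowerPart B := (rel_of_mem_blocks hB hy).2 hz
      simpa [h] using this
    · rintro ⟨⟨x, hx⟩, h⟩
      refine ⟨⟨{b | α.rel b (Sum.inl x)}, ⟨_, rfl⟩, ⟨x, α.rel.refl _⟩, ⟨y, α.rel.symm hx⟩⟩, not_not.2 ?_⟩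
      ext z
      constructor
      · intro hz
        exact h z (α.rel.symm (α.rel.trans hz hx))
      · rintro rfl
        exact α.rel.symm hx
  · exact fun B => B.2.2.2
  · exact fun B B' x h h' => Subtype.ext (eq_of_mem_blocks B.2.1 B'.2.1 h h')
  · exact fun B B' x h h' => Subtype.ext (eq_of_mem_blocks B.2.1 B'.2.1 h h')
  · intro B B' x h h'
    have := B.2.2.1
    rw [eq_of_mem_blocks B.2.1 B'.2.1 h h', B'.2.2] at this
    exact this.ne_empty rfl
  · intro x
    by_cases h : (upperPart {b | α.rel b (Sum.inr x)}).Nonempty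
    · exact Or.inl ⟨⟨_, ⟨_, rfl⟩, h, ⟨x, α.rel.refl _⟩⟩, α.rel.refl _⟩
    · exact Or.inr ⟨⟨_, ⟨_, rfl⟩, Set.not_nonempty_iff_eq_empty.1 h⟩, α.rel.refl _⟩

theorem sing_eq_mk_iff [Infinite X] (α : PartitionMonoid X) :
    α.sing = #X ↔ #α.star.lowerDefect = #X := by
  rw [sing, sum_subOne_add_sum_eq_mk_iff (fun B : α.transversals => upperPart B.1)
    (fun B : α.upperNontransversals => upperPart B.1)]
  · suffices h : {x | ∀ i : α.transversals, upperPart i.1 ≠ {x}} = α.star.lowerDefect by rw [h]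
    ext y
    rw [← not_iff_not, notMem_lowerDefect_star]
    refine not_forall.trans ⟨?_, ?_⟩
    · rintro ⟨⟨B, hB, _, ⟨x, hx⟩⟩, h⟩
      rw [not_not] at h
      have hy : Sum.inl y ∈ B := show y ∈ upperPart B from h ▸ rfl
      refine ⟨⟨x, (rel_of_mem_blocks hB hy).1 hx⟩, fun z hz => ?_⟩
      have : z ∈ upperPart B := (rel_of_mem_blocks hB hy).2 hz
      simpa [h] using this
    · rintro ⟨⟨x, hx⟩, h⟩
      refine ⟨⟨{b | α.rel b (Sum.inr x)}, ⟨_, rfl⟩, ⟨y, hx⟩, ⟨x, α.rel.refl _⟩⟩, not_not.2 ?_⟩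
      ext z
      constructor
      · intro hz
        exact h z (α.rel.trans hx (α.rel.symm hz))
      · rintro rfl
        exact hx
  · exact fun B => B.2.2.1
  · exact fun B B' x h h' => Subtype.ext (eq_of_mem_blocks B.2.1 B'.2.1 h h')
  · exact fun B B' x h h' => Subtype.ext (eq_of_mem_blocks B.2.1 B'.2.1 h h')
  · intro B B' x h h'
    have := B.2.2.2
    rw [eq_of_mem_blocks B.2.1 B'.2.1 h h', B'.2.2] at this
    exact this.ne_empty rfl
  · intro x
    by_cases h : (lowerPart {b | α.rel b (Sum.inl x)}).Nonempty
    · exact Or.inl ⟨⟨_, ⟨_, rfl⟩, ⟨x, α.rel.refl _⟩, h⟩, α.rel.refl _⟩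
    · exact Or.inr ⟨⟨_, ⟨_, rfl⟩, Set.not_nonempty_iff_eq_empty.1 h⟩, α.rel.refl _⟩

/-! ### Partitions with prescribed blocks -/

/-- The partition whose blocks are the `P i`, and singletons elsewhere. -/
def ofBlocks {ι : Type*} (P : ι → X ⊕ X → Prop) (hP : ∀ i j a, P i a → P j a → i = j) :
    PartitionMonoid X where
  rel :=
    { r := fun a b => a = b ∨ ∃ i, P i a ∧ P i b
      iseqv :=
        { refl := fun _ => Or.inl rfl
          symm := by
            rintro a b (rfl | ⟨i, h, h'⟩)
            · exact Or.inl rfl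
            · exact Or.inr ⟨i, h', h⟩
          trans := by
            rintro a b c (rfl | ⟨i, h, h'⟩) (rfl | ⟨j, k, k'⟩)
            · exact Or.inl rfl
            · exact Or.inr ⟨j, k, k'⟩
            · exact Or.inr ⟨i, h, h'⟩
            · obtain rfl := hP i j b h' k
              exact Or.inr ⟨i, h, k'⟩ } }

theorem Vertex.ofOuter_injective : Function.Injective (Vertex.ofOuter (X := X)) := by
  rintro (a | a) (b | b) h <;> cases h <;> rfl

section ofBlocks

variable {ι : Type*} {P : ι → X ⊕ X → Prop} {hP : ∀ i j a, P i a → P j a → i = j}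

theorem ofBlocks_rel {a b : X ⊕ X} :
    (ofBlocks P hP).rel a b ↔ a = b ∨ ∃ i, P i a ∧ P i b := Iff.rfl

theorem rel_ofBlocks {a b : X ⊕ X} {i : ι} (ha : P i a) (hb : P i b) :
    (ofBlocks P hP).rel a b := Or.inr ⟨i, ha, hb⟩

/-- The method for computing products: `N i` marks the vertices of all three rows that belong to
component i. Closure under edges bounds each component from above, `hconn` bounds it from below, and
unmarked outer vertices must already be isolated in their factor. -/
theorem mul_eq_ofBlocks {α β : PartitionMonoid X} (N : ι → Vertex X → Prop)
    (hN : ∀ i a, N i (Vertex.ofOuter a) ↔ P i a)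
    (hα : ∀ i a b, α.rel a b → N i (Vertex.ofFirst a) → N i (Vertex.ofFirst b))
    (hβ : ∀ i a b, β.rel a b → N i (Vertex.ofSecond a) → N i (Vertex.ofSecond b))
    (hl : ∀ x, (∀ i, ¬ P i (Sum.inl x)) → ∀ b, α.rel (Sum.inl x) b → b = Sum.inl x)
    (hr : ∀ y, (∀ i, ¬ P i (Sum.inr y)) → ∀ b, β.rel (Sum.inr y) b → b = Sum.inr y)
    (hconn : ∀ i a b, P i a → P i b → (α * β).rel a b) :
    α * β = ofBlocks P hP := by
  apply PartitionMonoid.ext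
  ext a b
  rw [ofBlocks_rel]
  constructor
  · intro h
    by_cases ha : ∃ i, P i a
    · obtain ⟨i, hi⟩ := ha
      exact Or.inr ⟨i, hi, (hN i b).1 (mem_of_eqvGen (N i) (hα i) (hβ i) h ((hN i a).2 hi))⟩
    · left
      push Not at ha
      refine Vertex.ofOuter_injective
        (mem_of_eqvGen (fun v => Vertex.ofOuter a = v) ?_ ?_ h rfl)
      · intro c d hcd h1
        rcases a with a | a <;> rcases c with c | c <;> cases h1
        rw [hl a ha d hcd]
        rfl
      · intro c d hcd h1
        rcases a with a | a <;> rcases c with c | c <;> cases h1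
        rw [hr a ha d hcd]
        rfl
  · rintro (rfl | ⟨i, ha, hb⟩)
    · exact (α * β).rel.refl _
    · exact hconn i a b ha hb

/-- The shared vertex z reconnects the two halves of each block in the middle row, and `hc` prevents
different blocks from meeting there. -/
theorem ofBlocks_mem_E (hz : ∀ i, ∃ z, P i (Sum.inl z) ∧ P i (Sum.inr z))
    (hc : ∀ i j z, P i (Sum.inl z) → P j (Sum.inr z) → i = j) : ofBlocks P hP ∈ E X := by
  refine mul_eq_ofBlocks (fun i v => match v with
      | .upper x => P i (Sum.inl x)
      | .middle x => P i (Sum.inl x) ∨ P i (Sum.inr x)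
      | .lower x => P i (Sum.inr x)) ?_ ?_ ?_ ?_ ?_ ?_
  · rintro i (a | a) <;> exact Iff.rfl
  · rintro i a b (rfl | ⟨j, ha, hb⟩) h1
    · exact h1
    · have : i = j := by
        rcases a with a | a
        · exact hP _ _ _ h1 ha
        · rcases h1 with h1 | h1
          · exact hc _ _ _ h1 ha
          · exact hP _ _ _ h1 ha
      subst this
      rcases b with b | b
      · exact hb
      · exact Or.inr hb
  · rintro i a b (rfl | ⟨j, ha, hb⟩) h1
    · exact h1
    · have : i = j := by
        rcases a with a | a
        · rcases h1 with h1 | h1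
          · exact hP _ _ _ h1 ha
          · exact (hc _ _ _ ha h1).symm
        · exact hP _ _ _ h1 ha
      subst this
      rcases b with b | b
      · exact Or.inl hb
      · exact hb
  · rintro x hx b (h | ⟨j, ha, hb⟩)
    · exact h.symm
    · exact (hx j ha).elim
  · rintro x hx b (h | ⟨j, ha, hb⟩)
    · exact h.symm
    · exact (hx j ha).elim
  · rintro i (a | a) (b | b) ha hb
    · exact mul_rel_inl _ (rel_ofBlocks ha hb)
    · obtain ⟨z, hz, hz'⟩ := hz i
      exact mul_rel_inl_inr (rel_ofBlocks ha hz') (rel_ofBlocks hz hb)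
    · obtain ⟨z, hz, hz'⟩ := hz i
      exact (_ * _ : PartitionMonoid X).rel.symm
        (mul_rel_inl_inr (rel_ofBlocks hb hz') (rel_ofBlocks hz ha))
    · exact mul_rel_inr _ (rel_ofBlocks ha hb)

end ofBlocks

/-! ### Injections as partitions -/

/-- The partition with blocks `{x, (f x)'}` and singletons. -/
def graph (f : X → X) (hf : f.Injective) : PartitionMonoid X :=
  ofBlocks (fun x a => Sum.elim (x = ·) (f x = ·) a) (by
    rintro i j (a | a) h h'
    · exact h.trans h'.symm
    · exact hf (h.trans h'.symm))

theorem graph_rel {f : X → X} (hf : f.Injective) {x : X} {a : X ⊕ X} :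
    (graph f hf).rel (Sum.inl x) a ↔ a = Sum.inl x ∨ a = Sum.inr (f x) := by
  rw [graph, ofBlocks_rel]
  constructor
  · rintro (h | ⟨i, h, h'⟩)
    · exact Or.inl h.symm
    · obtain rfl : i = x := h
      rcases a with a | a
      · obtain rfl : i = a := h'
        exact Or.inl rfl
      · obtain rfl : f i = a := h'
        exact Or.inr rfl
  · rintro (rfl | rfl)
    · exact Or.inl rfl
    · exact Or.inr ⟨x, rfl, rfl⟩

theorem graph_rel_self {f : X → X} (hf : f.Injective) (x : X) :
    (graph f hf).rel (Sum.inl x) (Sum.inr (f x)) := (graph_rel hf).2 (Or.inr rfl)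

theorem graph_mem_L {f : X → X} (hf : f.Injective) : graph f hf ∈ L X := by
  constructor
  · exact Set.eq_univ_of_forall fun x => ⟨f x, graph_rel_self hf x⟩
  · ext x y
    constructor
    · intro h
      rcases (graph_rel hf).1 h with h | h <;> cases h
      rfl
    · rintro rfl
      exact (graph f hf).ker.refl _

theorem compl_range_subset_lowerDefect_graph {f : X → X} (hf : f.Injective) :
    (Set.range f)ᶜ ⊆ (graph f hf).lowerDefect := by
  rintro y hy ⟨⟨x, hx⟩, -⟩
  rcases (graph_rel hf).1 hx with h | h <;> cases h
  exact hy ⟨x, rfl⟩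

/-- If the injection `f` picks a lower vertex in each transversal of `α`, then these can be moved
along `f x ↦ h x` by an idempotent. -/
theorem exists_mul_eq_graph {α : PartitionMonoid X} (hα : α ∈ L X) {f h : X → X}
    (hf : ∀ x, α.rel (Sum.inl x) (Sum.inr (f x))) (hh : h.Injective)
    (hfh : ∀ x y, f x = h y → x = y)
    (hαh : ∀ x b, α.rel (Sum.inr (h x)) b → α.rel (Sum.inl x) b ∨ b = Sum.inr (h x)) :
    ∃ e ∈ E X, α * e = graph h hh := by
  have hαα : ∀ x y z, α.rel (Sum.inl x) (Sum.inr z) → α.rel (Sum.inl y) (Sum.inr z) → x = y :=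
    fun x y z hx hy => eq_of_mem_L hα (α.rel.trans hx (α.rel.symm hy))
  have hαh' : ∀ x y, α.rel (Sum.inl y) (Sum.inr (h x)) → x = y := by
    intro x y hxy
    rcases hαh x _ (α.rel.symm hxy) with h1 | h1
    · exact eq_of_mem_L hα h1
    · cases h1
  -- The idempotent has blocks {f x, h x, (h x)'}. Including h x on top supplies the shared vertex
  -- required for idempotency; by `hαh` it attaches nothing new to x in the product.
  let P : X → X ⊕ X → Prop := fun x a => Sum.elim (fun z => f x = z ∨ h x = z) (h x = ·) a
  have hP : ∀ i j a, P i a → P j a → i = j := by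
    rintro i j (a | a) h1 h2
    · rcases h1 with rfl | rfl <;> rcases h2 with h2 | h2
      · exact hαα _ _ _ (hf i) (h2 ▸ hf j)
      · exact hfh _ _ h2.symm
      · exact (hfh _ _ h2).symm
      · exact hh h2.symm
    · exact hh (h1.trans h2.symm)
  refine ⟨ofBlocks P hP, ofBlocks_mem_E (fun i => ⟨h i, Or.inr rfl, rfl⟩) ?_, ?_⟩
  · rintro i j z h1 h2
    obtain rfl : h j = z := h2
    rcases h1 with h1 | h1
    · exact hfh _ _ h1
    · exact hh h1
  · have hconn : ∀ x, (α * ofBlocks P hP).rel (Sum.inl x) (Sum.inr (h x)) := fun x =>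
      mul_rel_inl_inr (hf x) (rel_ofBlocks (i := x) (Or.inl rfl) rfl)
    refine mul_eq_ofBlocks (fun i v => match v with
      | .upper x => i = x
      | .middle z => α.rel (Sum.inl i) (Sum.inr z) ∨ h i = z
      | .lower z => h i = z) ?_ ?_ ?_ ?_ ?_ ?_
    · rintro i (a | a) <;> exact Iff.rfl
    · rintro i (a | a) b hab h1
      · obtain rfl : i = a := h1
        rcases b with b | b
        · exact eq_of_mem_L hα hab
        · exact Or.inl hab
      · have : α.rel (Sum.inl i) b ∨ b = Sum.inr (h i) := by
          rcases h1 with h1 | rfl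
          · exact Or.inl (α.rel.trans h1 hab)
          · exact hαh i b hab
        rcases this with h2 | rfl
        · rcases b with b | b
          · exact eq_of_mem_L hα h2
          · exact Or.inl h2
        · exact Or.inr rfl
    · rintro i a b (rfl | ⟨j, ha, hb⟩) h1
      · exact h1
      · have : i = j := by
          rcases a with a | a
          · rcases ha with rfl | rfl <;> rcases h1 with h1 | h1
            · exact hαα _ _ _ h1 (hf j)
            · exact (hfh _ _ h1.symm).symm
            · exact (hαh' _ _ h1).symm
            · exact hh h1
          · exact hh (h1.trans ha.symm)
        subst this
        rcases b with b | b
        · rcases hb with rfl | rfl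
          · exact Or.inl (hf i)
          · exact Or.inr rfl
        · exact hb
    · exact fun x hx => (hx x rfl).elim
    · rintro y hy b (h1 | ⟨j, ha, hb⟩)
      · exact h1.symm
      · exact (hy j ha).elim
    · rintro i (a | a) (b | b) ha hb <;> cases ha <;> cases hb
      · exact (_ * _ : PartitionMonoid X).rel.refl _
      · exact hconn _
      · exact (_ * _ : PartitionMonoid X).rel.symm (hconn _)
      · exact (_ * _ : PartitionMonoid X).rel.refl _

/-- Two elements of `L_X` and `R_X` with independent ranges generate, together with the
idempotents, the whole monoid. -/
theorem exists_graph_mul_mul_star_graph {h g : X → X} (hh : h.Injective) (hg : g.Injective)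
    (hhg : ∀ x y, h x ≠ g y) (γ : PartitionMonoid X) :
    ∃ e ∈ E X, graph h hh * e * (graph g hg).star = γ := by
  let m : X ⊕ X → X := Sum.elim h g
  have hm : m.Injective := hh.sumElim hg hhg
  -- Copy each block of γ into X along the injection `m`, and use this copy as both the upper and
  -- the lower part of one block of the idempotent.
  let P : Quotient γ.rel → X ⊕ X → Prop := fun q a => ∃ c, ⟦c⟧ = q ∧ m c = Sum.elim id id a
  have hP : ∀ i j a, P i a → P j a → i = j := by
    rintro i j a ⟨c, rfl, hc⟩ ⟨d, rfl, hd⟩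
    rw [hm (hc.trans hd.symm)]
  have hPi : ∀ c, P ⟦c⟧ (Sum.inl (m c)) := fun c => ⟨c, rfl, rfl⟩
  have hPr : ∀ c, P ⟦c⟧ (Sum.inr (m c)) := fun c => ⟨c, rfl, rfl⟩
  -- Blocks of the partial product `graph h * e`: the upper row is decoded already, the lower row is
  -- still the copy along `m`.
  let Q : Quotient γ.rel → X ⊕ X → Prop := fun q a =>
    Sum.elim (fun x => (⟦Sum.inl x⟧ : Quotient γ.rel) = q) (fun z => P q (Sum.inr z)) a
  have hQ : ∀ i j a, Q i a → Q j a → i = j := by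
    rintro i j (a | a) h1 h2
    · exact h1.symm.trans h2
    · exact hP _ _ _ h1 h2
  have hgl : ∀ x, (graph h hh).rel (Sum.inl x) (Sum.inr (m (Sum.inl x))) := graph_rel_self hh
  have first : graph h hh * ofBlocks P hP = ofBlocks Q hQ := by
    refine mul_eq_ofBlocks (fun q v => match v with
      | .upper x => (⟦Sum.inl x⟧ : Quotient γ.rel) = q
      | .middle z => P q (Sum.inl z)
      | .lower z => P q (Sum.inr z)) ?_ ?_ ?_ ?_ ?_ ?_
    · rintro i (a | a) <;> exact Iff.rfl
    · rintro q a b (rfl | ⟨x, ha, hb⟩) h1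
      · exact h1
      · have : q = ⟦Sum.inl x⟧ := by
          rcases a with a | a <;> cases ha
          · exact h1.symm
          · exact hP _ _ _ h1 (hPi (Sum.inl x))
        subst this
        rcases b with b | b <;> cases hb
        · rfl
        · exact hPi (Sum.inl x)
    · rintro q a b (rfl | ⟨j, ha, hb⟩) h1
      · exact h1
      · have : q = j := by
          rcases a with a | a <;> exact hP _ _ _ h1 ha
        subst this
        rcases b with b | b <;> exact hb
    · exact fun x hx => (hx _ rfl).elim
    · rintro y hy b (h1 | ⟨j, ha, hb⟩)
      · exact h1.symm
      · exact (hy j ha).elim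
    · rintro q (a | a) (b | b) ha hb
      · exact mul_rel_inl_inl (hgl a)
          (rel_ofBlocks (i := q) (ha ▸ hPi _) (hb ▸ hPi _)) (hgl b)
      · exact mul_rel_inl_inr (hgl a) (rel_ofBlocks (i := q) (ha ▸ hPi _) hb)
      · exact (_ * _ : PartitionMonoid X).rel.symm
          (mul_rel_inl_inr (hgl b) (rel_ofBlocks (i := q) (hb ▸ hPi _) ha))
      · exact mul_rel_inr _ (rel_ofBlocks ha hb)
  have hgr : ∀ x, (graph g hg).star.rel (Sum.inl (m (Sum.inr x))) (Sum.inr x) := fun x =>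
    (graph g hg).rel.symm (graph_rel_self hg x)
  have hγ : γ = ofBlocks (fun q a => (⟦a⟧ : Quotient γ.rel) = q)
      (fun i j a h1 h2 => h1.symm.trans h2) := by
    apply PartitionMonoid.ext
    ext a b
    rw [ofBlocks_rel]
    constructor
    · exact fun hab => Or.inr ⟨_, rfl, (Quotient.sound hab).symm⟩
    · rintro (rfl | ⟨q, rfl, hb⟩)
      · exact γ.rel.refl _
      · exact γ.rel.symm (Quotient.exact hb)
  refine ⟨ofBlocks P hP, ofBlocks_mem_E (fun q => ?_) fun i j z h1 h2 => hP i j (Sum.inl z) h1 h2,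
    ?_⟩
  · induction q using Quotient.inductionOn with
    | h c => exact ⟨m c, hPi c, hPr c⟩
  · rw [first]
    conv_rhs => rw [hγ]
    refine mul_eq_ofBlocks (fun q v => match v with
      | .upper x => (⟦Sum.inl x⟧ : Quotient γ.rel) = q
      | .middle z => P q (Sum.inr z)
      | .lower y => (⟦Sum.inr y⟧ : Quotient γ.rel) = q) ?_ ?_ ?_ ?_ ?_ ?_
    · rintro i (a | a) <;> exact Iff.rfl
    · rintro q a b (rfl | ⟨j, ha, hb⟩) h1
      · exact h1
      · have : q = j := by
          rcases a with a | a
          · exact hQ q j (Sum.inl a) h1 ha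
          · exact hQ q j (Sum.inr a) h1 ha
        subst this
        rcases b with b | b <;> exact hb
    · rintro q a b (h2 | ⟨x, ha, hb⟩) h1
      · obtain rfl : a = b := by simpa using congrArg Sum.swap h2
        exact h1
      · have : q = ⟦Sum.inr x⟧ := by
          rcases a with a | a <;> cases ha
          · exact hP _ _ _ h1 (hPr (Sum.inr x))
          · exact h1.symm
        subst this
        rcases b with b | b <;> cases hb
        · exact hPr (Sum.inr x)
        · rfl
    · exact fun x hx => (hx _ rfl).elim
    · exact fun x hx => (hx _ rfl).elim
    · have hQr : ∀ q x, (⟦Sum.inr x⟧ : Quotient γ.rel) = q → Q q (Sum.inr (m (Sum.inr x))) :=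
        fun q x hx => hx ▸ hPr _
      rintro q (a | a) (b | b) ha hb
      · exact mul_rel_inl _ (rel_ofBlocks (i := q) ha hb)
      · exact mul_rel_inl_inr (rel_ofBlocks (i := q) ha (hQr q b hb)) (hgr b)
      · exact (_ * _ : PartitionMonoid X).rel.symm
          (mul_rel_inl_inr (rel_ofBlocks (i := q) hb (hQr q a ha)) (hgr a))
      · exact .trans _ _ _ (.symm _ _ (.rel _ _ (.second _ _ (hgr a)))) (.trans _ _ _
          (.rel _ _ (.first _ _ (rel_ofBlocks (i := q) (hQr q a ha) (hQr q b hb))))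
          (.rel _ _ (.second _ _ (hgr b))))

/-! ### Generation -/

/-- Choosing one lower vertex in each transversal of α gives f; the idempotent discards the unchosen
ones. -/
theorem exists_mul_eq_graph_of_mem_L {X : Type*} [Infinite X] {α : PartitionMonoid X} (hα : α ∈ L X)
    (h : #α.lowerDefect = #X) :
    ∃ (f : X → X) (hf : f.Injective), #((Set.range f)ᶜ : Set X) = #X ∧
      ∃ e ∈ E X, α * e = graph f hf := by
  choose f hf using exists_rel_of_mem_L hα
  have hinj : f.Injective := fun x y hxy =>
    eq_of_mem_L hα (α.rel.trans (hf x) (α.rel.symm (hxy ▸ hf y)))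
  refine ⟨f, hinj, ?_, exists_mul_eq_graph hα hf hinj (fun x y h => hinj h)
    fun x b hb => Or.inl (α.rel.trans (hf x) hb)⟩
  -- A chosen vertex that is defective shares its block with an unchosen one, and distinct chosen
  -- vertices lie in distinct blocks.
  have hle : #α.lowerDefect ≤ #((Set.range f)ᶜ : Set X) + #((Set.range f)ᶜ : Set X) := by
    refine mk_le_add_of_rel (fun x z => α.rel (Sum.inr x) (Sum.inr z)) ?_ ?_
    · intro y hy hyf
      obtain ⟨x, rfl⟩ := not_not.1 hyf
      by_contra! hcon
      refine hy ⟨⟨x, hf x⟩, fun z hz => ?_⟩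
      obtain ⟨w, rfl⟩ : z ∈ Set.range f := by
        by_contra hzf
        exact hcon z hzf hz
      rw [eq_of_mem_L hα (α.rel.trans (hf w) (α.rel.trans (α.rel.symm hz) (α.rel.symm (hf x))))]
    · intro x y z hx hy hxz hyz
      obtain ⟨u, rfl⟩ := not_not.1 hx
      obtain ⟨w, rfl⟩ := not_not.1 hy
      rw [eq_of_mem_L hα (α.rel.trans (hf u) (α.rel.trans (α.rel.trans hxz (α.rel.symm hyz))
        (α.rel.symm (hf w))))]
  refine le_antisymm (mk_set_le _) (not_lt.1 fun hlt => ?_)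
  exact absurd (h ▸ hle) (not_le.2 (add_lt_of_lt (aleph0_le_mk X) hlt hlt))

/-- The target vertices (h x)' are isolated in `graph f`, so moving onto them creates no collisions.
Disjointness of the ranges is what makes a single idempotent suffice. -/
theorem exists_graph_mul_eq_graph {f h : X → X} (hf : f.Injective) (hh : h.Injective)
    (hfh : ∀ x y, f x ≠ h y) : ∃ e ∈ E X, graph f hf * e = graph h hh := by
  refine exists_mul_eq_graph (graph_mem_L hf) (graph_rel_self hf) hh
    (fun x y hxy => (hfh x y hxy).elim) ?_
  rintro x b (hb | ⟨i, hi, -⟩)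
  · exact Or.inr hb.symm
  · exact (hfh i x hi).elim

theorem exists_injective_of_mk_eq {A : Set X} (h : #A = #X) :
    ∃ f : X → X, f.Injective ∧ ∀ x, f x ∈ A := by
  obtain ⟨e⟩ := Cardinal.eq.1 h
  exact ⟨fun x => e.symm x, Subtype.val_injective.comp e.symm.injective, fun x => (e.symm x).2⟩

theorem closure_eq_top [Infinite X] {α β : PartitionMonoid X} (hα : α ∈ L X) (hβ : β ∈ R X)
    (hαd : #α.lowerDefect = #X) (hβd : #β.star.lowerDefect = #X) :
    Subsemigroup.closure (E X ∪ {α, β}) = ⊤ := by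
  set T := Subsemigroup.closure (E X ∪ {α, β})
  have hE : ∀ {e}, e ∈ E X → e ∈ T := fun he => Subsemigroup.subset_closure (Or.inl he)
  have hαT : α ∈ T := Subsemigroup.subset_closure (Or.inr (Or.inl rfl))
  have hβT : β ∈ T := Subsemigroup.subset_closure (Or.inr (Or.inr rfl))
  obtain ⟨f, hf, hfr, e, he, hfe⟩ := exists_mul_eq_graph_of_mem_L hα hαd
  obtain ⟨g, hg, hgr, d, hd, hgd⟩ := exists_mul_eq_graph_of_mem_L (star_mem_L.2 hβ) hβd
  have hfT : graph f hf ∈ T := hfe ▸ T.mul_mem hαT (hE he)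
  have hgT : (graph g hg).star ∈ T := by
    rw [← hgd, star_mul, star_star]
    exact T.mul_mem (hE (star_mem_E hd)) hβT
  have move : ∀ {f h : X → X} (hf : f.Injective) (hh : h.Injective), graph f hf ∈ T →
      (∀ x y, f x ≠ h y) → graph h hh ∈ T := by
    intro f h hf hh hfT hfh
    obtain ⟨e, he, hfe⟩ := exists_graph_mul_eq_graph hf hh hfh
    exact hfe ▸ T.mul_mem hfT (hE he)
  obtain ⟨h, hh, hhT, hhg⟩ : ∃ (h : X → X) (hh : h.Injective), graph h hh ∈ T ∧
      ∀ x y, h x ≠ g y := by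
    -- If enough room avoids both ranges, one move suffices. Otherwise the complement of the range
    -- of f has |X| points inside the range of g: move first to k there, then to h outside the range
    -- of g, which is automatically disjoint from the range of k.
    by_cases hcap : #((Set.range f)ᶜ ∩ (Set.range g)ᶜ : Set X) = #X
    · obtain ⟨h, hh, hhr⟩ := exists_injective_of_mk_eq hcap
      exact ⟨h, hh, move hf hh hfT fun x y hxy => (hhr y).1 ⟨x, hxy⟩,
        fun x y hxy => (hhr x).2 ⟨y, hxy.symm⟩⟩
    · have hdiff : #((Set.range f)ᶜ ∩ Set.range g : Set X) = #X := by
        refine le_antisymm (mk_set_le _) (not_lt.1 fun hlt => ?_)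
        have hsub : #((Set.range f)ᶜ : Set X) ≤ #((Set.range f)ᶜ ∩ Set.range g : Set X) +
            #((Set.range f)ᶜ ∩ (Set.range g)ᶜ : Set X) := by
          refine le_trans (mk_le_mk_of_subset ?_) (mk_union_le _ _)
          rw [Set.inter_union_compl]
        exact absurd (hfr ▸ hsub) (not_le.2 (add_lt_of_lt (aleph0_le_mk X) hlt
          (lt_of_le_of_ne (mk_set_le _) hcap)))
      obtain ⟨k, hk, hkr⟩ := exists_injective_of_mk_eq hdiff
      obtain ⟨h, hh, hhr⟩ := exists_injective_of_mk_eq hgr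
      refine ⟨h, hh, move hk hh (move hf hk hfT fun x y hxy => (hkr y).1 ⟨x, hxy⟩) ?_,
        fun x y hxy => hhr x ⟨y, hxy.symm⟩⟩
      intro x y hxy
      exact hhr y (hxy ▸ (hkr x).2)
  refine eq_top_iff.2 fun γ _ => ?_
  obtain ⟨c, hc, rfl⟩ := exists_graph_mul_mul_star_graph hh hg hhg γ
  exact T.mul_mem (T.mul_mem hhT (hE hc)) hgT

/-! ### Necessity -/

theorem exists_mem_L_mk_lowerDefect_eq (X : Type*) [Infinite X] :
    ∃ γ ∈ L X, #γ.lowerDefect = #X := by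
  obtain ⟨e⟩ : Nonempty (X ⊕ X ≃ X) := by
    rw [← Cardinal.eq, mk_sum]
    simp
  have hf : Function.Injective (fun x => e (Sum.inl x)) := e.injective.comp Sum.inl_injective
  refine ⟨graph _ hf, graph_mem_L hf, le_antisymm (mk_set_le _) ?_⟩
  refine le_trans ?_ (mk_le_mk_of_subset (compl_range_subset_lowerDefect_graph hf))
  refine mk_le_of_injective (f := fun x : X => ⟨e (Sum.inr x), ?_⟩) ?_
  · rintro ⟨y, hy⟩
    cases e.injective hy
  · intro x y hxy
    exact Sum.inr_injective (e.injective (congrArg Subtype.val hxy))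

theorem exists_mem_L_notMem_R [Infinite X] {α β : PartitionMonoid X}
    (h : Subsemigroup.closure (E X ∪ S X ∪ {α, β}) = ⊤) :
    (α ∈ L X ∧ α ∉ R X) ∨ (β ∈ L X ∧ β ∉ R X) := by
  by_contra! hcon
  obtain ⟨γ, hγ, hγd⟩ := exists_mem_L_mk_lowerDefect_eq X
  have hgen : ∀ g ∈ E X ∪ S X ∪ {α, β}, g ∈ L X → g ∈ R X := by
    rintro g ((hg | hg) | rfl | rfl) hgL
    · rw [eq_one_of_mem_E_of_mem_L hg hgL]
      exact mem_R_of_isUnit isUnit_one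
    · exact mem_R_of_isUnit hg
    · exact hcon.1 hgL
    · exact hcon.2 hgL
  -- When xy ∈ L, the factor x lies in L, hence in R, so it is a unit; cancelling it puts y in L as
  -- well.
  have key : ∀ δ ∈ Subsemigroup.closure (E X ∪ S X ∪ {α, β}), δ ∈ L X → δ ∈ R X := by
    intro δ hδ
    induction hδ using Subsemigroup.closure_induction with
    | mem g hg => exact hgen g hg
    | mul x y _ _ hx hy =>
      intro hxy
      have hxR := hx (mem_L_of_mul hxy)
      exact mul_mem_R hxR
        (hy (mem_L_of_mul_of_isUnit (isUnit_of_mem (mem_L_of_mul hxy) hxR) hxy))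
  have hγR := key γ (h ▸ Subsemigroup.mem_top γ) hγ
  rw [lowerDefect_of_mem_R hγR, mk_eq_zero] at hγd
  exact mk_ne_zero X hγd.symm

/-- Right multiplication by a generator keeps a small defect small as long as the product stays in
L, whereas some element of L has defect |X|. -/
theorem mk_lowerDefect_eq_of_closure_eq_top [Infinite X] {α β : PartitionMonoid X}
    (hα : α ∈ L X) (hβ : β ∈ R X) (h : Subsemigroup.closure (E X ∪ S X ∪ {α, β}) = ⊤) :
    #α.lowerDefect = #X := by
  by_contra hne
  have hαd : #α.lowerDefect < #X := lt_of_le_of_ne (mk_set_le _) hne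
  have hadd : ∀ {c d : Cardinal}, c < #X → d < #X → c + d < #X :=
    add_lt_of_lt (aleph0_le_mk X)
  have hR : ∀ g ∈ R X, #g.lowerDefect < #X := fun g hg => by
    rw [lowerDefect_of_mem_R hg, mk_eq_zero]
    exact pos_iff_ne_zero.2 (mk_ne_zero X)
  -- The prefix γ is quantified inside the induction because the bound for an idempotent depends on
  -- what stands to its left; for a product xy the second factor is applied to the prefix γx.
  have key : ∀ δ ∈ Subsemigroup.closure (E X ∪ S X ∪ {α, β}),
      ∀ γ ∈ L X, #γ.lowerDefect < #X → γ * δ ∈ L X → #(γ * δ).lowerDefect < #X := by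
    intro δ hδ
    induction hδ using Subsemigroup.closure_induction with
    | mem g hg =>
      intro γ hγ hγd hγg
      refine (mk_lowerDefect_mul_le γ g).trans_lt (hadd ?_ hγd)
      rcases hg with (hg | hg) | rfl | rfl
      · have := (mk_lowerDefect_star_le hγg).trans_lt (hadd hγd hγd)
        exact (mk_lowerDefect_le_of_mem_E hg).trans_lt (hadd this this)
      · exact hR g (mem_R_of_isUnit hg)
      · exact hαd
      · exact hR g hβ
    | mul x y _ _ hx hy =>
      intro γ hγ hγd hγg
      rw [← mul_assoc] at hγg ⊢
      have hγx := mem_L_of_mul hγg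
      exact hy _ hγx (hx γ hγ hγd hγx) hγg
  obtain ⟨γ, hγ, hγd⟩ := exists_mem_L_mk_lowerDefect_eq X
  have := key γ (h ▸ Subsemigroup.mem_top γ) 1 (mem_L_iff.2 ⟨1, one_mul 1⟩)
    (hR 1 (mem_R_of_isUnit isUnit_one)) (by rwa [one_mul])
  rw [one_mul, hγd] at this
  exact this.false

theorem closure_star_eq_top {α β : PartitionMonoid X}
    (h : Subsemigroup.closure (E X ∪ S X ∪ {α, β}) = ⊤) :
    Subsemigroup.closure (E X ∪ S X ∪ {β.star, α.star}) = ⊤ := by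
  have key : ∀ δ ∈ Subsemigroup.closure (E X ∪ S X ∪ {α, β}),
      δ.star ∈ Subsemigroup.closure (E X ∪ S X ∪ {β.star, α.star}) := by
    intro δ hδ
    induction hδ using Subsemigroup.closure_induction with
    | mem g hg =>
      apply Subsemigroup.subset_closure
      rcases hg with (hg | hg) | rfl | rfl
      · exact Or.inl (Or.inl (star_mem_E hg))
      · exact Or.inl (Or.inr (star_mem_S hg))
      · exact Or.inr (Or.inr rfl)
      · exact Or.inr (Or.inl rfl)
    | mul x y _ _ hx hy =>
      rw [star_mul]
      exact Subsemigroup.mul_mem _ hy hx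
  refine eq_top_iff.2 fun γ _ => ?_
  rw [← star_star γ]
  exact key _ (h ▸ Subsemigroup.mem_top _)

theorem cosing_sing_of_closure_eq_top [Infinite X] {α β : PartitionMonoid X}
    (hα : α ∈ L X) (hβ : β ∈ R X) (h : Subsemigroup.closure (E X ∪ S X ∪ {α, β}) = ⊤) :
    α.cosing = #X ∧ β.sing = #X :=
  ⟨(cosing_eq_mk_iff α).2 (mk_lowerDefect_eq_of_closure_eq_top hα hβ h),
    (sing_eq_mk_iff β).2 (mk_lowerDefect_eq_of_closure_eq_top (star_mem_L.2 hβ)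
      (star_mem_R.2 hα) (closure_star_eq_top h))⟩

end PartitionMonoid

open PartitionMonoid in
theorem mainTheorem5 {X : Type*} [Infinite X] (α β : PartitionMonoid X) :
    List.TFAE [
      Subsemigroup.closure (PartitionMonoid.E X ∪ {α, β}) = ⊤,
      Subsemigroup.closure (PartitionMonoid.E X ∪ PartitionMonoid.S X ∪ {α, β}) = ⊤,
      (α ∈ PartitionMonoid.L X ∧ β ∈ PartitionMonoid.R X ∧
          α.cosing = Cardinal.mk X ∧ β.sing = Cardinal.mk X) ∨
        (β ∈ PartitionMonoid.L X ∧ α ∈ PartitionMonoid.R X ∧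
          β.cosing = Cardinal.mk X ∧ α.sing = Cardinal.mk X)] := by
  tfae_have 1 → 2 := by
    intro h
    rw [eq_top_iff, ← h]
    exact Subsemigroup.closure_mono (Set.union_subset_union_left _ Set.subset_union_left)
  tfae_have 2 → 3 := by
    intro h
    have hL := exists_mem_L_notMem_R h
    have hR := exists_mem_L_notMem_R (closure_star_eq_top h)
    rw [star_mem_L, star_mem_L, star_mem_R, star_mem_R] at hR
    rcases hL with ⟨hL, hnR⟩ | ⟨hL, hnR⟩
    -- `hR` says that β or α lies in R but not in L; since α ∈ L, it must be β.
    · have hβ : β ∈ R X := by tauto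
      exact Or.inl ⟨hL, hβ, cosing_sing_of_closure_eq_top hL hβ h⟩
    · have hα : α ∈ R X := by tauto
      rw [Set.pair_comm] at h
      exact Or.inr ⟨hL, hα, cosing_sing_of_closure_eq_top hL hα h⟩
  tfae_have 3 → 1 := by
    rintro (⟨hL, hR, h1, h2⟩ | ⟨hL, hR, h1, h2⟩)
    · exact closure_eq_top hL hR ((cosing_eq_mk_iff α).1 h1) ((sing_eq_mk_iff β).1 h2)
    · rw [Set.pair_comm]
      exact closure_eq_top hL hR ((cosing_eq_mk_iff β).1 h1) ((sing_eq_mk_iff α).1 h2)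
  tfae_finish
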